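/- Let $G=(V,E,c)$ be an electrical network: $(V,E)$ is a connected simple undirected graph with finitely or countably many vertices, $c\colon V\times V\to[0,\infty)$ is symmetric, $c(x,y)>0$ if and only if $\{x,y\}\in E$, and $c(x):=\sum_{y\in V}c(x,y)<\infty$ for all $x\in V$. Let $$\mathcal E(f,g)=\tfrac12\sum_{x,y\in V}c(x,y)(f(x)-f(y))(g(x)-g(y)),\qquad \mathcal F=\{f\in\mathbb R^V:\mathcal E(f,f)<\infty\},$$ and $R(x,y)=\sup\{|f(x)-f(y)|^2/\mathcal E(f,f): f\in\mathcal F,\ \mathcal E(f,f)>0\}$. For $A,A'\subseteq V$ let $R(A,A')=\big(\inf\{\mathcal E(f,f): f\in\mathcal F,\ f|_A=1,\ f|_{A'}=0\}\big)^{-1}$ (which is $0$ if there is no such $f$, and $\infty$ if the infimum is $0$). Assume that $G$ is recurrent, in the sense that $\lim_{r\to\infty}R(\{\rho\},\{y\in V: R(\rho,y)<r\}^c)=\infty$ for some $\rho\in V$. Let $\mathcal F^{(1)}$ be the closure of the finitely supported functions in $\mathcal F$ with respect to the norm $(\mathcal E(u,u)+u(x_0)^2)^{1/2}$ (which does not depend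 on $x_0\in V$). Let $B\subseteq V$ be any nonempty set (its complement need not be finite). For a function $\varphi$ on $B$ which is the restriction of an element of $\mathcal F^{(1)}$, let $h_B(\varphi)$ be the unique minimizer of $\mathcal E(u,u)$ among the $u\in\mathcal F^{(1)}$ with $u|_B=\varphi$. The conductances of the trace $G|_B$ of $G$ onto $B$ are $$c_{G|_B}(x,y)=-\mathcal E\big(h_B(1_{\{x\}}),h_B(1_{\{y\}})\big)\quad(x,y\in B,\ x\ne y),\qquad c_{G|_B}(x,x)=0 .$$ Let $(Y(n))_{n\ge0}$ be, under $P_x$, the discrete-time Markov chain on $V$ started at $x$ with transition probabilities $c(z,w)/c(z)$, and let $T_B^+=\inf\{n>0: Y(n)\in B\}$. Then, for all $x,y\in B$ with $x\neq y$, $$c_{G|_B}(x,y)=c(x)\,P_x\big(T_B^+<\infty,\ Y(T_B^+)=y\big).$$ -/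

import Mathlib

open MeasureTheory Filter Topology
open scoped ENNReal

/-- An electrical network on the vertex set `V`: a connected simple graph with symmetric
nonnegative conductances which are positive exactly on the edges, and whose total conductance at
every vertex is finite. The vertex set carries the discrete topology. -/
structure ElectricalNetwork (V : Type*) where
  graph : SimpleGraph V
  connected : graph.Connected
  cond : V → V → ℝ
  cond_nonneg : ∀ x y, 0 ≤ cond x y
  cond_symm : ∀ x y, cond x y = cond y x
  cond_pos_iff : ∀ x y, 0 < cond x y ↔ graph.Adj x y
  cond_summable : ∀ x, Summable (cond x)

namespace ElectricalNetwork

noncomputable section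

variable {V : Type*} (G : ElectricalNetwork V)

/-- The total conductance `c_G(x) = ∑_y c_G(x,y)`. -/
def totalCond (x : V) : ℝ := ∑' y, G.cond x y

/-- The transition probabilities `P_G(x,y) = c_G(x,y) / c_G(x)`. -/
def trans (x y : V) : ℝ := G.cond x y / G.totalCond x

/-- `Y` is, under the probability measure `P`, the discrete-time Markov chain associated with `G`
started at `x`. The state space `V` carries its discrete σ-algebra. -/
structure IsChainFrom {Ω : Type*} [MeasurableSpace Ω] (P : Measure Ω) (Y : ℕ → Ω → V)
    (x : V) : Prop where
  isProbabilityMeasure : IsProbabilityMeasure P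
  measurable : ∀ n, Measurable[_, ⊤] (Y n)
  start : ∀ᵐ ω ∂P, Y 0 ω = x
  step : ∀ (n : ℕ) (p : ℕ → V),
    P.real {ω | ∀ k ≤ n + 1, Y k ω = p k} =
      P.real {ω | ∀ k ≤ n, Y k ω = p k} * G.trans (p n) (p (n + 1))

/-- The energy form
`ℰ_G(f,g) = (1/2) ∑_{x,y} c_G(x,y) (f(x) - f(y)) (g(x) - g(y))`; it is only used for
`f, g` of finite energy, where the sum converges absolutely. -/
def energy (f g : V → ℝ) : ℝ :=
  (1 / 2) * ∑' p : V × V, G.cond p.1 p.2 * (f p.1 - f p.2) * (g p.1 - g p.2)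

/-- The domain `ℱ_G` of the resistance form: the functions of finite energy. -/
def domain : Set (V → ℝ) :=
  {f | Summable fun p : V × V => G.cond p.1 p.2 * (f p.1 - f p.2) ^ 2}

/-- The resistance metric
`R_G(x,y) = sup {|f(x) - f(y)|² / ℰ_G(f,f) : f ∈ ℱ_G, ℰ_G(f,f) > 0}`. -/
def resistance (x y : V) : ℝ≥0∞ :=
  ⨆ f : {f : V → ℝ // f ∈ G.domain ∧ 0 < G.energy f f},
    ENNReal.ofReal (|f.1 x - f.1 y| ^ 2 / G.energy f.1 f.1)

/-- The open ball of radius `r` around `x` in the resistance metric. -/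
def resistanceBall (x : V) (r : ℝ) : Set V := {y | G.resistance x y < ENNReal.ofReal r}

/-- The effective resistance between two sets,
`R(A,B) = (inf {ℰ_G(f,f) : f ∈ ℱ_G, f = 1 on A, f = 0 on B})⁻¹`;
it is `0` if there is no such `f`, and `∞` if the infimum is `0`. -/
def setResistance (A B : Set V) : ℝ≥0∞ :=
  (⨅ f : {f : V → ℝ // f ∈ G.domain ∧ (∀ x ∈ A, f x = 1) ∧ ∀ x ∈ B, f x = 0},
    ENNReal.ofReal (G.energy f.1 f.1))⁻¹

/-- The resistance form of `G` is recurrent: `R(ρ, B_R(ρ,r)ᶜ) → ∞` as `r → ∞` for some `ρ`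
(equivalently, for every `ρ`). -/
def IsRecurrent : Prop :=
  ∃ ρ : V, Tendsto (fun r : ℝ => G.setResistance {ρ} (G.resistanceBall ρ r)ᶜ) atTop (𝓝 ⊤)

/-- The space `ℱ⁽¹⁾`: the closure of the compactly (i.e. finitely) supported functions in `ℱ_G`
with respect to the norm `(ℰ_G(u,u) + u(x₀)²)^{1/2}`. The closure does not depend on the base
point `x₀`. -/
def domainOne : Set (V → ℝ) :=
  {u | u ∈ G.domain ∧ ∀ x₀ : V, ∀ ε > 0, ∃ v ∈ G.domain, (Function.support v).Finite ∧
    G.energy (u - v) (u - v) + (u x₀ - v x₀) ^ 2 < ε}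

/-- `h` minimizes the energy among the functions in `ℱ⁽¹⁾` that agree with `φ` on `B`. -/
def IsEnergyMinimizer (B : Set V) (φ : B → ℝ) (h : V → ℝ) : Prop :=
  (h ∈ G.domainOne ∧ ∀ b : B, h b = φ b) ∧
    ∀ u ∈ G.domainOne, (∀ b : B, u b = φ b) → G.energy h h ≤ G.energy u u

open Classical in
/-- The harmonic extension `h_B⁽¹⁾(φ)`: the unique energy minimizer in `ℱ⁽¹⁾` with values `φ`
on `B` (and `0` if there is none). -/
def harmonicExt (B : Set V) (φ : B → ℝ) : V → ℝ :=
  if H : ∃! h : V → ℝ, G.IsEnergyMinimizer B φ h then H.choose else 0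

/-- The trace of the form onto `B`: `ℰ_G|_B(φ,ψ) = ℰ_G(h_B⁽¹⁾(φ), h_B⁽¹⁾(ψ))`. -/
def traceEnergy (B : Set V) (φ ψ : B → ℝ) : ℝ :=
  G.energy (G.harmonicExt B φ) (G.harmonicExt B ψ)

open Classical in
/-- The conductances of the trace `G|_B`: `c_{G|_B}(x,y) = -ℰ_G|_B(1_{x}, 1_{y})` for `x ≠ y`,
and `c_{G|_B}(x,x) = 0`. -/
def traceCond (B : Set V) (x y : B) : ℝ :=
  if x = y then 0
  else -G.traceEnergy B (Set.indicator {x} (fun _ => 1)) (Set.indicator {y} (fun _ => 1))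

end

end ElectricalNetwork

/-- The first return time `T_B⁺ = inf {n > 0 : Y(n) ∈ B}`, with value `∞` if there is no
such `n`. -/
noncomputable def returnTime {V Ω : Type*} (Y : ℕ → Ω → V) (B : Set V) (ω : Ω) : ℕ∞ :=
  ⨅ n : {n : ℕ // 0 < n ∧ Y n ω ∈ B}, (n.1 : ℕ∞)

/-! Up to a factor 2 the energy is the ℓ² inner product of weighted gradients, and `grad` kills only
constants. Let M = `gradClosure B`. Each element of M is again the gradient of a function vanishing
on B, and by truncation every function of ℱ⁽¹⁾ vanishing on B has its gradient in M
(`grad_mem_gradClosure_of_mem_domainOne`). Hence h_B(1_y) arises from 1_y by removing the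
M-component of its gradient (`exists_harmonic`, `harmonicExt_eq`).

Put h = h_B(1_y). The gradients of h_B(1_x) and 1_x differ by an element of M and grad h ⟂ M, so
ℰ(h_B(1_x), h) = ℰ(1_x, h) = c(x)h(x) - ∑ c(x,w)h(w). Since h(x) = 0, the trace conductance is ∑
c(x,w)h(w) = c(x) ∑ P(x,w)h(w).

It remains to see that h(w) is the probability that the chain from w first meets B at y
(`ofReal_eq_iSup_hitProb`); conditioning on the first step then finishes
(`IsChainFrom.measure_return`). As h is nonnegative and harmonic off B, it dominates the probability
of doing so within n steps. Conversely, the hitting probabilities of the chain killed outside finite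
sets lie below the unkilled ones, and by Pythagoras they are at least as close to h in energy as any
given finitely supported approximants, so they converge to h. -/

namespace ElectricalNetwork

variable {V : Type*} (G : ElectricalNetwork V)

/-! ### Energy as an ℓ² norm of gradients -/

/-- The weighted gradient `√c(x,y) (f(x) - f(y))` of a function. -/
noncomputable def gradFun (f : V → ℝ) (p : V × V) : ℝ := √(G.cond p.1 p.2) * (f p.1 - f p.2)

lemma gradFun_mul_gradFun (f g : V → ℝ) (p : V × V) :
    G.gradFun f p * G.gradFun g p = G.cond p.1 p.2 * (f p.1 - f p.2) * (g p.1 - g p.2) := by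
  have h := Real.mul_self_sqrt (G.cond_nonneg p.1 p.2)
  unfold gradFun
  linear_combination (f p.1 - f p.2) * (g p.1 - g p.2) * h

lemma gradFun_sq (f : V → ℝ) (p : V × V) :
    G.gradFun f p ^ 2 = G.cond p.1 p.2 * (f p.1 - f p.2) ^ 2 := by
  rw [sq, gradFun_mul_gradFun]; ring

lemma memℓp_two_iff {ι : Type*} (f : ι → ℝ) : Memℓp f 2 ↔ Summable fun i => f i ^ 2 := by
  rw [memℓp_gen_iff (by norm_num)]
  simp

lemma memℓp_gradFun_iff (f : V → ℝ) : Memℓp (G.gradFun f) 2 ↔ f ∈ G.domain := by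
  rw [memℓp_two_iff]
  simp only [gradFun_sq]
  rfl

/-- The functions of finite energy as a vector space. -/
def domainSubmodule : Submodule ℝ (V → ℝ) where
  carrier := G.domain
  add_mem' {f g} hf hg := by
    rw [← memℓp_gradFun_iff] at *
    convert hf.add hg using 1
    ext p; simp only [gradFun, Pi.add_apply]; ring
  zero_mem' := by
    rw [← memℓp_gradFun_iff]
    convert zero_memℓp (E := fun _ : V × V => ℝ) (p := 2) using 1
    ext p; simp [gradFun]
  smul_mem' c f hf := by
    rw [← memℓp_gradFun_iff] at *
    convert hf.const_smul c using 1
    ext p; simp only [gradFun, Pi.smul_apply, smul_eq_mul]; ring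

/-- The weighted gradient as a linear map into `ℓ²(V × V)`. -/
noncomputable def grad : G.domainSubmodule →ₗ[ℝ] lp (fun _ : V × V => ℝ) 2 where
  toFun f := ⟨G.gradFun f, (G.memℓp_gradFun_iff f).2 f.2⟩
  map_add' f g := by
    ext p; simp only [gradFun, lp.coeFn_add, Pi.add_apply, Submodule.coe_add]; ring
  map_smul' c f := by
    ext p; simp only [gradFun, lp.coeFn_smul, Pi.smul_apply, smul_eq_mul, Submodule.coe_smul,
      RingHom.id_apply]; ring

@[simp] lemma grad_apply (f : G.domainSubmodule) (p : V × V) :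
    G.grad f p = G.gradFun f p := rfl

lemma inner_grad (f g : G.domainSubmodule) :
    inner ℝ (G.grad f) (G.grad g) = 2 * G.energy f g := by
  rw [lp.inner_eq_tsum, energy, ← mul_assoc]
  norm_num
  refine tsum_congr fun p => ?_
  rw [mul_comm, gradFun_mul_gradFun]

lemma energy_eq_norm (f : G.domainSubmodule) : G.energy f f = 1 / 2 * ‖G.grad f‖ ^ 2 := by
  rw [← real_inner_self_eq_norm_sq, inner_grad]; ring

lemma abs_gradFun_le (f : G.domainSubmodule) (p : V × V) : |G.gradFun f p| ≤ ‖G.grad f‖ := by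
  simpa using lp.norm_apply_le_norm (by norm_num) (G.grad f) p

/-- Each edge ab of a walk from z to w contributes c(a,b)^{-1/2}. As C does not depend on f, ℓ²
convergence of gradients together with convergence at one vertex gives pointwise convergence. -/
lemma exists_abs_sub_le (z w : V) :
    ∃ C : ℝ, 0 ≤ C ∧ ∀ f : G.domainSubmodule, |f.1 z - f.1 w| ≤ C * ‖G.grad f‖ := by
  obtain ⟨W⟩ := G.connected.preconnected z w
  induction W with
  | nil => exact ⟨0, le_rfl, fun f => by simp⟩
  | @cons a b c hab W ih =>
    obtain ⟨C, hC, h⟩ := ih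
    have hs : 0 < √(G.cond a b) := Real.sqrt_pos.2 ((G.cond_pos_iff a b).2 hab)
    refine ⟨(√(G.cond a b))⁻¹ + C, by positivity, fun f => ?_⟩
    have h1 := G.abs_gradFun_le f (a, b)
    rw [gradFun, abs_mul, abs_of_pos hs] at h1
    have h2 : |f.1 a - f.1 b| ≤ (√(G.cond a b))⁻¹ * ‖G.grad f‖ := by
      rw [inv_mul_eq_div, le_div_iff₀ hs]; linarith
    calc |f.1 a - f.1 c| ≤ |f.1 a - f.1 b| + |f.1 b - f.1 c| := abs_sub_le _ _ _
      _ ≤ _ := by linarith [h f]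

lemma eq_zero_of_grad_eq_zero {f : G.domainSubmodule} (h : G.grad f = 0) {b : V}
    (hb : f.1 b = 0) : f = 0 := by
  ext z
  obtain ⟨C, -, hC⟩ := G.exists_abs_sub_le z b
  simpa [h, hb] using hC f

lemma tendsto_apply_of_tendsto_grad {ι : Type*} {l : Filter ι} {v : ι → G.domainSubmodule}
    {u : G.domainSubmodule} (h : Tendsto (fun n => G.grad (v n)) l (𝓝 (G.grad u))) {b : V}
    (hb : Tendsto (fun n => (v n).1 b) l (𝓝 (u.1 b))) (z : V) :
    Tendsto (fun n => (v n).1 z) l (𝓝 (u.1 z)) := by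
  obtain ⟨C, -, hC⟩ := G.exists_abs_sub_le z b
  have h1 : Tendsto (fun n => C * ‖G.grad (v n) - G.grad u‖) l (𝓝 0) := by
    simpa using (tendsto_iff_norm_sub_tendsto_zero.1 h).const_mul C
  have h2 : Tendsto (fun n => ((v n).1 z - u.1 z) - ((v n).1 b - u.1 b)) l (𝓝 0) := by
    refine squeeze_zero_norm (fun n => ?_) h1
    rw [← map_sub]
    exact hC (v n - u)
  have h3 := (h2.add hb).add_const (u.1 z - u.1 b)
  refine (h3.congr fun n => ?_).trans_eq ?_
  · ring
  · congr 1; ring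

/-! ### Finitely supported functions off B and their gradient closure -/

/-- The finitely supported functions that vanish on `B`. -/
def finsuppOff (B : Set V) : Submodule ℝ G.domainSubmodule where
  carrier := {f | (Function.support f.1).Finite ∧ ∀ b ∈ B, f.1 b = 0}
  add_mem' {f g} hf hg :=
    ⟨(hf.1.union hg.1).subset (Function.support_add f.1 g.1),
      fun b hb => by simp [hf.2 b hb, hg.2 b hb]⟩
  zero_mem' := ⟨by simp, by simp⟩
  smul_mem' c f hf :=
    ⟨hf.1.subset (Function.support_const_smul_subset c f.1), fun b hb => by simp [hf.2 b hb]⟩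

/-- The closure of the gradients of the finitely supported functions that vanish on `B`. -/
noncomputable def gradClosure (B : Set V) : Submodule ℝ (lp (fun _ : V × V => ℝ) 2) :=
  ((G.finsuppOff B).map G.grad).topologicalClosure

instance (B : Set V) : CompleteSpace (G.gradClosure B) :=
  (Submodule.isClosed_topologicalClosure _).completeSpace_coe

lemma grad_mem_gradClosure {B : Set V} {f : G.domainSubmodule} (hf : f ∈ G.finsuppOff B) :
    G.grad f ∈ G.gradClosure B :=
  Submodule.le_topologicalClosure _ (Submodule.mem_map_of_mem hf)

lemma exists_seq_of_mem_gradClosure {B : Set V} {m : lp (fun _ : V × V => ℝ) 2}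
    (hm : m ∈ G.gradClosure B) :
    ∃ v : ℕ → G.domainSubmodule, (∀ n, v n ∈ G.finsuppOff B) ∧
      Tendsto (fun n => G.grad (v n)) atTop (𝓝 m) := by
  rw [gradClosure, ← SetLike.mem_coe, Submodule.topologicalClosure_coe] at hm
  obtain ⟨s, hs, hlim⟩ := mem_closure_iff_seq_limit.1 hm
  choose v hv hvs using hs
  exact ⟨v, hv, by simpa [hvs] using hlim⟩

lemma tendsto_lp_apply {ι κ : Type*} {l : Filter κ} {v : κ → lp (fun _ : ι => ℝ) 2}
    {m : lp (fun _ : ι => ℝ) 2} (h : Tendsto v l (𝓝 m)) (i : ι) :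
    Tendsto (fun n => v n i) l (𝓝 (m i)) := by
  rw [tendsto_iff_norm_sub_tendsto_zero] at h ⊢
  refine squeeze_zero (fun _ => norm_nonneg _) (fun n => ?_) h
  exact lp.norm_apply_le_norm (by norm_num) (v n - m) i

/-- Vanishing at a point b of B fixes the additive constant, so the approximating functions are
pointwise Cauchy; their limit is the required function. -/
lemma exists_grad_eq_of_mem_gradClosure {B : Set V} (hB : B.Nonempty)
    {m : lp (fun _ : V × V => ℝ) 2} (hm : m ∈ G.gradClosure B) :
    ∃ φ : G.domainSubmodule, G.grad φ = m ∧ ∀ b ∈ B, φ.1 b = 0 := by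
  obtain ⟨v, hv, hlim⟩ := G.exists_seq_of_mem_gradClosure hm
  obtain ⟨b, hb⟩ := hB
  have hcau : ∀ z, ∃ a, Tendsto (fun n => (v n).1 z) atTop (𝓝 a) := by
    intro z
    obtain ⟨C, hC, h⟩ := G.exists_abs_sub_le z b
    refine cauchySeq_tendsto_of_complete ?_
    have hc := hlim.cauchySeq
    rw [Metric.cauchySeq_iff] at hc ⊢
    intro ε hε
    obtain ⟨N, hN⟩ := hc (ε / (C + 1)) (by positivity)
    refine ⟨N, fun i hi j hj => ?_⟩
    have h1 := h (v i - v j)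
    have h2 := hN i hi j hj
    rw [dist_eq_norm, ← map_sub, lt_div_iff₀ (by positivity)] at h2
    simp only [Submodule.coe_sub, Pi.sub_apply, (hv i).2 b hb, (hv j).2 b hb, sub_zero] at h1
    rw [Real.dist_eq]
    nlinarith [norm_nonneg (G.grad (v i - v j))]
  choose φ hφ using hcau
  have hgrad : ∀ p, G.gradFun φ p = m p := fun p =>
    tendsto_nhds_unique (((hφ p.1).sub (hφ p.2)).const_mul _) (tendsto_lp_apply hlim p)
  have hmem : φ ∈ G.domain := by
    rw [← memℓp_gradFun_iff, funext hgrad]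
    exact lp.memℓp m
  refine ⟨⟨φ, hmem⟩, ?_, fun c hc => ?_⟩
  · ext p; exact hgrad p
  · refine tendsto_nhds_unique (hφ c) ?_
    simp [(hv _).2 c hc]

lemma exists_seq_of_mem_domainOne {u : G.domainSubmodule} (hu : u.1 ∈ G.domainOne) :
    ∃ v : ℕ → G.domainSubmodule, (∀ n, (Function.support (v n).1).Finite) ∧
      Tendsto (fun n => G.grad (v n)) atTop (𝓝 (G.grad u)) ∧
      ∀ z, Tendsto (fun n => (v n).1 z) atTop (𝓝 (u.1 z)) := by
  obtain ⟨b⟩ := G.connected.nonempty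
  have h : ∀ n : ℕ, ∃ v : G.domainSubmodule, (Function.support v.1).Finite ∧
      1 / 2 * ‖G.grad (v - u)‖ ^ 2 + (v.1 b - u.1 b) ^ 2 < 1 / ((n : ℝ) + 1) := by
    intro n
    obtain ⟨v, hv, hf, hlt⟩ := hu.2 b (1 / ((n : ℝ) + 1)) (by positivity)
    refine ⟨⟨v, hv⟩, hf, ?_⟩
    have h1 := G.energy_eq_norm (u - ⟨v, hv⟩)
    rw [map_sub, norm_sub_rev, ← map_sub] at h1
    rw [← h1, sub_sq_comm]
    exact hlt
  choose v hf hlt using h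
  have hlim := tendsto_one_div_add_atTop_nhds_zero_nat (𝕜 := ℝ)
  have h1 : Tendsto (fun n => G.grad (v n)) atTop (𝓝 (G.grad u)) := by
    rw [tendsto_iff_norm_sub_tendsto_zero]
    have : Tendsto (fun n => ‖G.grad (v n) - G.grad u‖ ^ 2) atTop (𝓝 0) := by
      refine squeeze_zero (fun _ => by positivity) (fun n => ?_) 
        (by simpa using hlim.const_mul 2 :
          Tendsto (fun n : ℕ => 2 * (1 / ((n : ℝ) + 1))) atTop (𝓝 0))
      rw [← map_sub]
      nlinarith [hlt n, sq_nonneg ((v n).1 b - u.1 b)]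
    simpa using this.sqrt
  refine ⟨v, hf, h1, G.tendsto_apply_of_tendsto_grad h1 (b := b) ?_⟩
  rw [tendsto_iff_norm_sub_tendsto_zero]
  have : Tendsto (fun n => ((v n).1 b - u.1 b) ^ 2) atTop (𝓝 0) := by
    refine squeeze_zero (fun _ => by positivity) (fun n => ?_) hlim
    nlinarith [hlt n, sq_nonneg ‖G.grad (v n - u)‖]
  simpa [Real.sqrt_sq_eq_abs] using this.sqrt

/-! ### Truncation and weak convergence in ℱ⁽¹⁾ -/

/-- Finite truncations of `a` approximate it in norm, and the bound on `v n` controls the remainder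
uniformly. Clamped functions below have only bounded energies, so weak convergence is what is
available. -/
lemma tendsto_inner_of_bounded {ι : Type*} (a : lp (fun _ : ι => ℝ) 2)
    {v : ℕ → lp (fun _ : ι => ℝ) 2} {m : lp (fun _ : ι => ℝ) 2} {C : ℝ}
    (hC : ∀ n, ‖v n‖ ≤ C) (h : ∀ i, Tendsto (fun n => v n i) atTop (𝓝 (m i))) :
    Tendsto (fun n => inner ℝ a (v n)) atTop (𝓝 (inner ℝ a m)) := by
  classical
  have hC0 : 0 ≤ C := (norm_nonneg _).trans (hC 0)
  have hsingle := lp.hasSum_single (p := 2) (by norm_num) a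
  have hsum : ∀ (s : Finset ι) (w : lp (fun _ : ι => ℝ) 2),
      inner ℝ (∑ i ∈ s, lp.single 2 i (a i)) w = ∑ i ∈ s, a i * w i := by
    intro s w
    rw [sum_inner]
    refine Finset.sum_congr rfl fun i _ => ?_
    rw [lp.inner_single_left]
    simp [mul_comm]
  rw [Metric.tendsto_atTop]
  intro ε hε
  set D := C + ‖m‖ + 1 with hD
  have hDpos : 0 < D := by positivity
  obtain ⟨s, hs⟩ := ((Metric.tendsto_nhds.1 hsingle) (ε / (2 * D)) (by positivity)).exists
  have hfin : Tendsto (fun n => ∑ i ∈ s, a i * v n i) atTop (𝓝 (∑ i ∈ s, a i * m i)) :=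
    tendsto_finsetSum _ fun i _ => (h i).const_mul _
  obtain ⟨N, hN⟩ := (Metric.tendsto_atTop.1 hfin) (ε / 2) (by positivity)
  refine ⟨N, fun n hn => ?_⟩
  have h1 := hN n hn
  set t := ∑ i ∈ s, lp.single 2 i (a i)
  rw [← hsum, ← hsum, Real.dist_eq, ← inner_sub_right] at h1
  rw [dist_comm, dist_eq_norm] at hs
  rw [Real.dist_eq, ← inner_sub_right]
  have h2 : |inner ℝ (a - t) (v n - m)| ≤ ε / (2 * D) * D := by
    refine (abs_real_inner_le_norm _ _).trans ?_
    refine mul_le_mul hs.le ?_ (norm_nonneg _) (by positivity)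
    calc ‖v n - m‖ ≤ ‖v n‖ + ‖m‖ := norm_sub_le _ _
      _ ≤ D := by linarith [hC n]
  have h3 : ε / (2 * D) * D = ε / 2 := by field_simp
  have h4 : inner ℝ a (v n - m) = inner ℝ (a - t) (v n - m) + inner ℝ t (v n - m) := by
    rw [inner_sub_left]; ring
  rw [h4]
  calc _ ≤ |inner ℝ (a - t) (v n - m)| + |inner ℝ t (v n - m)| := abs_add_le _ _
    _ < ε := by linarith

lemma abs_clamp_sub_clamp_le (a b s t : ℝ) :
    |max (-|s|) (min a |s|) - max (-|t|) (min b |t|)| ≤ |a - b| + |s - t| := by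
  have h0 := abs_abs_sub_abs_le_abs_sub s t
  have h1 := abs_max_sub_max_le_max (-|s|) (min a |s|) (-|t|) (min b |t|)
  have h2 := abs_min_sub_min_le_max a |s| b |t|
  have h3 : |(-|s|) - (-|t|)| ≤ |s - t| := by
    rw [neg_sub_neg, abs_sub_comm]; exact h0
  refine h1.trans (max_le ?_ (h2.trans (max_le ?_ ?_))) <;>
    linarith [abs_nonneg (a - b), abs_nonneg (s - t)]

lemma gradFun_sq_le_of_abs_sub_le {f g k : V → ℝ} {p : V × V}
    (h : |f p.1 - f p.2| ≤ |g p.1 - g p.2| + |k p.1 - k p.2|) :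
    G.gradFun f p ^ 2 ≤ 2 * G.gradFun g p ^ 2 + 2 * G.gradFun k p ^ 2 := by
  simp only [gradFun_sq]
  have h1 : (f p.1 - f p.2) ^ 2 ≤ 2 * (g p.1 - g p.2) ^ 2 + 2 * (k p.1 - k p.2) ^ 2 := by
    rw [← sq_abs (f p.1 - f p.2), ← sq_abs (g p.1 - g p.2), ← sq_abs (k p.1 - k p.2)]
    nlinarith [abs_nonneg (f p.1 - f p.2), sq_nonneg (|g p.1 - g p.2| - |k p.1 - k p.2|)]
  nlinarith [G.cond_nonneg p.1 p.2]

lemma norm_grad_sq (f : G.domainSubmodule) :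
    HasSum (fun p => G.gradFun f p ^ 2) (‖G.grad f‖ ^ 2) := by
  rw [← real_inner_self_eq_norm_sq]
  simpa [sq] using lp.hasSum_inner (𝕜 := ℝ) (G.grad f) (G.grad f)

lemma exists_grad_le_of_abs_sub_le {f : V → ℝ} (g k : G.domainSubmodule)
    (h : ∀ a b, |f a - f b| ≤ |g.1 a - g.1 b| + |k.1 a - k.1 b|) :
    ∃ hf : f ∈ G.domain,
      ‖G.grad ⟨f, hf⟩‖ ^ 2 ≤ 2 * ‖G.grad g‖ ^ 2 + 2 * ‖G.grad k‖ ^ 2 := by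
  have hs := ((G.norm_grad_sq g).mul_left 2).add ((G.norm_grad_sq k).mul_left 2)
  have hle := fun p : V × V => G.gradFun_sq_le_of_abs_sub_le (h p.1 p.2)
  have hf : f ∈ G.domain := by
    rw [← memℓp_gradFun_iff, memℓp_two_iff]
    exact Summable.of_nonneg_of_le (fun _ => sq_nonneg _) hle hs.summable
  exact ⟨hf, hasSum_le hle (G.norm_grad_sq ⟨f, hf⟩) hs⟩

/-- Approximants of `u` need not vanish on B. Clamping them to [-|u|, |u|] forces this, keeps
supports finite and energies bounded, and does not change the pointwise limit. -/
lemma grad_mem_gradClosure_of_mem_domainOne {B : Set V} {u : G.domainSubmodule}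
    (hu : u.1 ∈ G.domainOne) (hB : ∀ b ∈ B, u.1 b = 0) : G.grad u ∈ G.gradClosure B := by
  -- A closed subspace is its own double orthogonal complement, so testing against `r` ⟂ M is
  -- enough.
  rw [← Submodule.orthogonal_orthogonal (G.gradClosure B), Submodule.mem_orthogonal]
  intro r hr
  obtain ⟨v, hfin, hgrad, hpt⟩ := G.exists_seq_of_mem_domainOne hu
  set φ : ℕ → V → ℝ := fun n z => max (-|u.1 z|) (min ((v n).1 z) |u.1 z|) with hφ
  choose hdom hbound using fun n => G.exists_grad_le_of_abs_sub_le (f := φ n) (v n) u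
    fun a b => abs_clamp_sub_clamp_le _ _ _ _
  have hmem : ∀ n, (⟨φ n, hdom n⟩ : G.domainSubmodule) ∈ G.finsuppOff B := by
    refine fun n => ⟨(hfin n).subset fun z hz hz' => hz ?_, fun b hb => ?_⟩
    · simp [hφ, hz']
    · simp [hφ, hB b hb]
  have hzero : ∀ n, inner ℝ r (G.grad ⟨φ n, hdom n⟩) = 0 := fun n => by
    rw [real_inner_comm]
    exact (Submodule.mem_orthogonal _ _).1 hr _ (G.grad_mem_gradClosure (hmem n))
  obtain ⟨C, hC⟩ := hgrad.norm.bddAbove_range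
  have hφpt : ∀ z, Tendsto (fun n => φ n z) atTop (𝓝 (u.1 z)) := by
    intro z
    have h1 := tendsto_const_nhds (x := -|u.1 z|).max
      ((hpt z).min (tendsto_const_nhds (x := |u.1 z|)))
    rwa [min_eq_left (le_abs_self _), max_eq_right (neg_abs_le _)] at h1
  have hlim := tendsto_inner_of_bounded r (v := fun n => G.grad ⟨φ n, hdom n⟩) (m := G.grad u)
    (C := √(2 * C ^ 2 + 2 * ‖G.grad u‖ ^ 2)) (fun n => ?_)
    (fun p => ((hφpt p.1).sub (hφpt p.2)).const_mul _)
  · simp only [hzero] at hlim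
    exact (tendsto_nhds_unique hlim tendsto_const_nhds)
  · refine Real.le_sqrt_of_sq_le ((hbound n).trans ?_)
    have h1 : ‖G.grad (v n)‖ ≤ C := hC ⟨n, rfl⟩
    gcongr

lemma mem_domainOne_iff {u : G.domainSubmodule} :
    u.1 ∈ G.domainOne ↔ ∃ v : ℕ → G.domainSubmodule,
      (∀ n, (Function.support (v n).1).Finite) ∧
      Tendsto (fun n => G.grad (v n)) atTop (𝓝 (G.grad u)) ∧
      ∀ z, Tendsto (fun n => (v n).1 z) atTop (𝓝 (u.1 z)) := by
  refine ⟨G.exists_seq_of_mem_domainOne, fun ⟨v, hfin, hgrad, hpt⟩ => ⟨u.2, fun z ε hε => ?_⟩⟩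
  have h1 := ((tendsto_iff_norm_sub_tendsto_zero.1 hgrad).pow 2).const_mul (1 / 2)
  have h2 := ((tendsto_iff_norm_sub_tendsto_zero.1 (hpt z))).pow 2
  have h3 := h1.add h2
  norm_num at h3
  obtain ⟨n, hn⟩ := (h3.eventually_lt_const hε).exists
  refine ⟨v n, (v n).2, hfin n, ?_⟩
  have h4 := G.energy_eq_norm (u - v n)
  rw [map_sub, norm_sub_rev] at h4
  rw [← Submodule.coe_sub, h4, sub_sq_comm]
  convert hn using 2

lemma sub_mem_domainOne {u v : G.domainSubmodule} (hu : u.1 ∈ G.domainOne)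
    (hv : v.1 ∈ G.domainOne) : (u - v).1 ∈ G.domainOne := by
  rw [mem_domainOne_iff] at *
  obtain ⟨a, ha, hag, hap⟩ := hu
  obtain ⟨b, hb, hbg, hbp⟩ := hv
  refine ⟨fun n => a n - b n, fun n => ?_, ?_, fun z => (hap z).sub (hbp z)⟩
  · exact ((ha n).union (hb n)).subset (Function.support_sub _ _)
  · simp only [map_sub]
    exact hag.sub hbg

/-! ### Harmonic extension by orthogonal projection -/

/-- The energy minimizer in `ℱ⁽¹⁾` with the values of `s` on `B`. -/
lemma exists_harmonic {B : Set V} (hB : B.Nonempty) (s : G.domainSubmodule)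
    (hs : (Function.support s.1).Finite) :
    ∃ h : G.domainSubmodule, h.1 ∈ G.domainOne ∧ (∀ b ∈ B, h.1 b = s.1 b) ∧
      G.grad (h - s) ∈ G.gradClosure B ∧ G.grad h ∈ (G.gradClosure B)ᗮ := by
  obtain ⟨m, hm, r, hr, hmr⟩ := (G.gradClosure B).exists_add_mem_mem_orthogonal (G.grad s)
  obtain ⟨φ, hφ, hφB⟩ := G.exists_grad_eq_of_mem_gradClosure hB hm
  obtain ⟨v, hv, hlim⟩ := G.exists_seq_of_mem_gradClosure hm
  rw [← hφ] at hlim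
  obtain ⟨b, hb⟩ := hB
  have hpt := G.tendsto_apply_of_tendsto_grad hlim (b := b)
    (by simp [hφB b hb, (hv _).2 b hb])
  refine ⟨s - φ, ?_, fun b hb => by simp [hφB b hb], ?_, ?_⟩
  · rw [mem_domainOne_iff]
    refine ⟨fun n => s - v n, fun n => ?_, ?_, fun z => tendsto_const_nhds.sub (hpt z)⟩
    · exact (hs.union (hv n).1).subset (Function.support_sub _ _)
    · simp only [map_sub]
      exact tendsto_const_nhds.sub hlim
  · rw [sub_sub_cancel_left, map_neg, hφ]
    exact neg_mem hm
  · rw [map_sub, hφ, hmr, add_sub_cancel_left]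
    exact hr

lemma norm_grad_sq_eq_add {B : Set V} {h u : G.domainSubmodule}
    (hh : G.grad h ∈ (G.gradClosure B)ᗮ) (hu : G.grad (u - h) ∈ G.gradClosure B) :
    ‖G.grad u‖ ^ 2 = ‖G.grad h‖ ^ 2 + ‖G.grad (u - h)‖ ^ 2 := by
  have h1 := (Submodule.mem_orthogonal' _ _).1 hh _ hu
  have h2 : G.grad u = G.grad h + G.grad (u - h) := by rw [map_sub]; abel
  rw [h2, norm_add_sq_real, h1]; ring

/-- A competitor differs from `h` by an element of ℱ⁽¹⁾ vanishing on B, whose gradient is orthogonal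
to that of `h`. Pythagoras gives minimality; equality forces equal gradients, and a point of B fixes
the constant. -/
lemma harmonicExt_eq {B : Set V} (hB : B.Nonempty) {h : G.domainSubmodule}
    (hone : h.1 ∈ G.domainOne) (hh : G.grad h ∈ (G.gradClosure B)ᗮ) {φ : B → ℝ}
    (hφ : ∀ b : B, h.1 b = φ b) : G.harmonicExt B φ = h.1 := by
  have key : ∀ u : G.domainSubmodule, u.1 ∈ G.domainOne → (∀ b : B, u.1 b = φ b) →
      ‖G.grad u‖ ^ 2 = ‖G.grad h‖ ^ 2 + ‖G.grad (u - h)‖ ^ 2 := fun u hu huφ =>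
    G.norm_grad_sq_eq_add hh (G.grad_mem_gradClosure_of_mem_domainOne
      (G.sub_mem_domainOne hu hone) fun b hb => by simp [huφ ⟨b, hb⟩, hφ ⟨b, hb⟩])
  have hmin : G.IsEnergyMinimizer B φ h.1 := by
    refine ⟨⟨hone, hφ⟩, fun u hu huφ => ?_⟩
    have h1 := key ⟨u, hu.1⟩ hu huφ
    have h2 := G.energy_eq_norm ⟨u, hu.1⟩
    have h3 := G.energy_eq_norm h
    simp only at h2
    rw [h2, h3, h1]
    nlinarith [sq_nonneg ‖G.grad (⟨u, hu.1⟩ - h)‖]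
  have huniq : ∀ u, G.IsEnergyMinimizer B φ u → u = h.1 := by
    intro u hu
    have h1 := key ⟨u, hu.1.1.1⟩ hu.1.1 hu.1.2
    have h2 := G.energy_eq_norm ⟨u, hu.1.1.1⟩
    have h3 := G.energy_eq_norm h
    have h4 := hu.2 h.1 hone hφ
    simp only at h2
    rw [h2, h3] at h4
    have h5 : ‖G.grad (⟨u, hu.1.1.1⟩ - h)‖ = 0 := by
      rw [← sq_eq_zero_iff]
      nlinarith [sq_nonneg ‖G.grad (⟨u, hu.1.1.1⟩ - h)‖]
    obtain ⟨b, hb⟩ := hB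
    have h6 := G.eq_zero_of_grad_eq_zero (norm_eq_zero.1 h5) (b := b)
      (by simp [hu.1.2 ⟨b, hb⟩, hφ ⟨b, hb⟩])
    exact congrArg Subtype.val (sub_eq_zero.1 h6)
  have H : ∃! h : V → ℝ, G.IsEnergyMinimizer B φ h := ⟨h.1, hmin, huniq⟩
  rw [harmonicExt, dif_pos H]
  exact huniq _ H.choose_spec.1

/-! ### Vertex indicators and the Laplacian -/

lemma hasSum_of_fst_eq {T : V × V → ℝ} {z : V} {s : ℝ} (hT : ∀ a b, a ≠ z → T (a, b) = 0)
    (h : HasSum (fun b => T (z, b)) s) : HasSum T s := by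
  have hinj : Function.Injective (fun b : V => (z, b)) := Prod.mk_right_injective z
  refine (hinj.hasSum_iff ?_).1 h
  rintro ⟨a, b⟩ hab
  refine hT a b ?_
  rintro rfl
  exact hab ⟨b, rfl⟩

lemma hasSum_add_swap {T : V × V → ℝ} {z : V} {s : ℝ} (hT : ∀ a b, a ≠ z → T (a, b) = 0)
    (h : HasSum (fun b => T (z, b)) s) : HasSum (fun p => T p + T p.swap) (2 * s) := by
  have h1 := hasSum_of_fst_eq hT h
  rw [two_mul]
  exact h1.add ((Equiv.prodComm V V).hasSum_iff.2 h1)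

lemma indicator_mem_domain (z : V) : Set.indicator {z} (fun _ => (1 : ℝ)) ∈ G.domain := by
  classical
  set f : V → ℝ := Set.indicator {z} (fun _ => (1 : ℝ)) with hf
  have h := hasSum_add_swap (T := fun p => f p.1 * G.cond p.1 p.2) (z := z)
    (s := G.totalCond z) (fun a b hab => by simp [hf, hab])
    (by simpa [hf, totalCond] using (G.cond_summable z).hasSum)
  refine Summable.of_nonneg_of_le (fun p => mul_nonneg (G.cond_nonneg _ _) (sq_nonneg _))
    (fun p => ?_) h.summable
  have h1 : (f p.1 - f p.2) ^ 2 ≤ f p.1 + f p.2 := by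
    simp only [hf, Set.indicator_apply]
    split_ifs <;> norm_num
  simp only [Prod.fst_swap, Prod.snd_swap]
  rw [G.cond_symm p.2 p.1]
  nlinarith [G.cond_nonneg p.1 p.2]

/-- The indicator function of a vertex, as a function of finite energy. -/
noncomputable def delta (z : V) : G.domainSubmodule :=
  ⟨Set.indicator {z} (fun _ => 1), G.indicator_mem_domain z⟩

lemma delta_self (z : V) : (G.delta z).1 z = 1 := by simp [delta]

lemma delta_of_ne {z w : V} (h : w ≠ z) : (G.delta z).1 w = 0 := by simp [delta, h]

lemma support_delta_finite (z : V) : (Function.support (G.delta z).1).Finite :=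
  (Set.finite_singleton z).subset Set.support_indicator_subset

lemma summable_cond_mul_sub (f : G.domainSubmodule) (z : V) :
    Summable fun w => G.cond z w * (f.1 z - f.1 w) := by
  have h1 : Summable fun w => G.cond z w * (f.1 z - f.1 w) ^ 2 :=
    (show Summable _ from f.2).comp_injective (Prod.mk_right_injective z)
  refine Summable.of_norm_bounded ((G.cond_summable z).add h1) fun w => ?_
  rw [Real.norm_eq_abs, abs_mul, abs_of_nonneg (G.cond_nonneg z w)]
  have h2 : |f.1 z - f.1 w| ≤ 1 + (f.1 z - f.1 w) ^ 2 := by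
    rw [← sq_abs]
    nlinarith [sq_nonneg (|f.1 z - f.1 w| - 1), abs_nonneg (f.1 z - f.1 w)]
  nlinarith [G.cond_nonneg z w]

/-- Only ordered pairs containing z contribute; each edge at z occurs in both orders, which cancels
the factor 1/2. -/
lemma energy_delta (f : G.domainSubmodule) (z : V) :
    G.energy (G.delta z).1 f.1 = ∑' w, G.cond z w * (f.1 z - f.1 w) := by
  have h := hasSum_add_swap
    (T := fun p => (G.delta z).1 p.1 * (G.cond p.1 p.2 * (f.1 p.1 - f.1 p.2))) (z := z)
    (fun a b hab => by simp [G.delta_of_ne hab])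
    (by simpa [G.delta_self] using (G.summable_cond_mul_sub f z).hasSum)
  have h2 : ∀ p : V × V, G.cond p.1 p.2 * ((G.delta z).1 p.1 - (G.delta z).1 p.2) *
      (f.1 p.1 - f.1 p.2) = (G.delta z).1 p.1 * (G.cond p.1 p.2 * (f.1 p.1 - f.1 p.2)) +
        (G.delta z).1 p.2 * (G.cond p.2 p.1 * (f.1 p.2 - f.1 p.1)) := fun p => by
    rw [G.cond_symm p.2 p.1]; ring
  rw [energy, tsum_congr h2]
  simp only [Prod.fst_swap, Prod.snd_swap] at h
  rw [h.tsum_eq]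
  ring

lemma summable_cond_mul (f : G.domainSubmodule) (z : V) :
    Summable fun w => G.cond z w * f.1 w := by
  have := ((G.cond_summable z).mul_right (f.1 z)).sub (G.summable_cond_mul_sub f z)
  refine this.congr fun w => ?_
  ring

lemma inner_grad_delta (f : G.domainSubmodule) (z : V) :
    inner ℝ (G.grad (G.delta z)) (G.grad f) =
      2 * (G.totalCond z * f.1 z - ∑' w, G.cond z w * f.1 w) := by
  rw [inner_grad, energy_delta, totalCond, ← tsum_mul_right,
    ← ((G.cond_summable z).mul_right _).tsum_sub (G.summable_cond_mul f z)]
  simp only [mul_sub]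

/-- Functions orthogonal to the finitely supported functions off `B` are harmonic off `B`. -/
lemma tsum_cond_mul_eq {B : Set V} {h : G.domainSubmodule} (hh : G.grad h ∈ (G.gradClosure B)ᗮ)
    {z : V} (hz : z ∉ B) : ∑' w, G.cond z w * h.1 w = G.totalCond z * h.1 z := by
  have h1 : G.delta z ∈ G.finsuppOff B :=
    ⟨G.support_delta_finite z, fun b hb => G.delta_of_ne fun e => hz (e ▸ hb)⟩
  have h2 := (Submodule.mem_orthogonal _ _).1 hh _ (G.grad_mem_gradClosure h1)
  rw [inner_grad_delta] at h2
  linarith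

/-! ### Hitting probabilities, with and without killing -/

lemma trans_nonneg (z w : V) : 0 ≤ G.trans z w :=
  div_nonneg (G.cond_nonneg z w) (tsum_nonneg (G.cond_nonneg z))

lemma sum_trans_le_one (z : V) (K : Finset V) : ∑ w ∈ K, G.trans z w ≤ 1 := by
  simp only [trans]
  rw [← Finset.sum_div]
  exact div_le_one_of_le₀ ((G.cond_summable z).sum_le_tsum K fun w _ => G.cond_nonneg z w)
    (tsum_nonneg (G.cond_nonneg z))

lemma totalCond_pos [Nontrivial V] (z : V) : 0 < G.totalCond z := by
  obtain ⟨w, hw⟩ := G.connected.preconnected.exists_adj_of_nontrivial z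
  exact (G.cond_summable z).tsum_pos (G.cond_nonneg z) w ((G.cond_pos_iff z w).2 hw)

lemma totalCond_mul_trans [Nontrivial V] (z w : V) :
    G.totalCond z * G.trans z w = G.cond z w :=
  mul_div_cancel₀ _ (G.totalCond_pos z).ne'

open Classical in
/-- The probability that the chain started at `z` visits `B` by time `n`, with first point `y`. -/
noncomputable def hitProb (B : Set V) (y : V) : ℕ → V → ℝ≥0∞
  | 0, z => Set.indicator {y} (fun _ => 1) z
  | n + 1, z => if z ∈ B then Set.indicator {y} (fun _ => 1) z
      else ∑' w, ENNReal.ofReal (G.trans z w) * hitProb B y n w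

open Classical in
/-- Lower bounds for the probability that the chain started at `z` visits `B` by time `n`, with
first point `y`, and does not leave the finite set `K` before. -/
noncomputable def killedHitProb (B : Set V) (y : V) (K : Finset V) : ℕ → V → ℝ
  -- Starting from zero makes the sequence increasing without any assumption on y.
  | 0, _ => 0
  | n + 1, z => if z ∈ B then Set.indicator {y} (fun _ => 1) z
      else if z ∈ K then ∑ w ∈ K, G.trans z w * killedHitProb B y K n w else 0

lemma monotone_hitProb {B : Set V} {y : V} (hy : y ∈ B) (z : V) :
    Monotone fun n => G.hitProb B y n z := by
  refine monotone_nat_of_le_succ fun n => ?_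
  induction n generalizing z with
  | zero =>
    by_cases hz : z ∈ B
    · simp [hitProb, hz]
    · have : z ≠ y := fun e => hz (e ▸ hy)
      simp [hitProb, this]
  | succ n ih =>
    rw [hitProb, hitProb]
    split_ifs with hz
    · exact le_rfl
    · exact ENNReal.tsum_le_tsum fun w => mul_le_mul_right (ih w) _

lemma killedHitProb_nonneg (B : Set V) (y : V) (K : Finset V) (n : ℕ) (z : V) :
    0 ≤ G.killedHitProb B y K n z := by
  induction n generalizing z with
  | zero => simp [killedHitProb]
  | succ n ih =>
    rw [killedHitProb]
    split_ifs
    · exact Set.indicator_nonneg (fun _ _ => zero_le_one) z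
    · exact Finset.sum_nonneg fun w _ => mul_nonneg (G.trans_nonneg z w) (ih w)
    · exact le_rfl

lemma killedHitProb_le_one (B : Set V) (y : V) (K : Finset V) (n : ℕ) (z : V) :
    G.killedHitProb B y K n z ≤ 1 := by
  induction n generalizing z with
  | zero => simp [killedHitProb]
  | succ n ih =>
    rw [killedHitProb]
    split_ifs
    · exact Set.indicator_apply_le' (fun _ => le_rfl) fun _ => zero_le_one
    · refine le_trans (Finset.sum_le_sum fun w _ => ?_) (G.sum_trans_le_one z K)
      exact mul_le_of_le_one_right (G.trans_nonneg z w) (ih w)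
    · exact zero_le_one

lemma monotone_killedHitProb (B : Set V) (y : V) (K : Finset V) (z : V) :
    Monotone fun n => G.killedHitProb B y K n z := by
  refine monotone_nat_of_le_succ fun n => ?_
  induction n generalizing z with
  | zero => exact G.killedHitProb_nonneg B y K 1 z
  | succ n ih =>
    rw [killedHitProb, killedHitProb]
    split_ifs
    · exact le_rfl
    · exact Finset.sum_le_sum fun w _ => mul_le_mul_of_nonneg_left (ih w) (G.trans_nonneg z w)
    · exact le_rfl

lemma ofReal_killedHitProb_le (B : Set V) (y : V) (K : Finset V) (n : ℕ) (z : V) :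
    ENNReal.ofReal (G.killedHitProb B y K n z) ≤ G.hitProb B y n z := by
  induction n generalizing z with
  | zero => simp [killedHitProb]
  | succ n ih =>
    rw [killedHitProb, hitProb]
    split_ifs
    · by_cases h : z = y <;> simp [h]
    · rw [ENNReal.ofReal_sum_of_nonneg fun w _ =>
        mul_nonneg (G.trans_nonneg z w) (G.killedHitProb_nonneg B y K n w)]
      refine le_trans (Finset.sum_le_sum fun w _ => ?_) (ENNReal.sum_le_tsum K)
      rw [ENNReal.ofReal_mul (G.trans_nonneg z w)]
      exact mul_le_mul_right (ih w) _
    · simp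

/-- The limit of the hitting probabilities of the chain killed outside a finite set. -/
lemma exists_killed_limit (B : Set V) (y : V) (K : Finset V) :
    ∃ p : V → ℝ, (∀ z, 0 ≤ p z) ∧
      (∀ z, ENNReal.ofReal (p z) ≤ ⨆ n, G.hitProb B y n z) ∧
      (∀ z ∈ B, p z = Set.indicator {y} (fun _ => 1) z) ∧
      (∀ z ∉ B, z ∉ K → p z = 0) ∧
      ∀ z ∉ B, z ∈ K → p z = ∑ w ∈ K, G.trans z w * p w := by
  have hlim : ∀ z, Tendsto (fun n => G.killedHitProb B y K n z) atTop
      (𝓝 (⨆ n, G.killedHitProb B y K n z)) := fun z =>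
    tendsto_atTop_ciSup (G.monotone_killedHitProb B y K z)
      ⟨1, by rintro _ ⟨n, rfl⟩; exact G.killedHitProb_le_one B y K n z⟩
  have hsucc := fun z => (tendsto_add_atTop_iff_nat 1).2 (hlim z)
  refine ⟨fun z => ⨆ n, G.killedHitProb B y K n z, fun z => ?_, fun z => ?_, fun z hz => ?_,
    fun z hz hzK => ?_, fun z hz hzK => ?_⟩
  · exact ge_of_tendsto' (hlim z) fun n => G.killedHitProb_nonneg B y K n z
  · exact le_of_tendsto' ((ENNReal.continuous_ofReal.tendsto _).comp (hlim z)) fun n =>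
      (G.ofReal_killedHitProb_le B y K n z).trans (le_iSup (fun n => G.hitProb B y n z) n)
  · refine tendsto_nhds_unique (hsucc z) ?_
    simp [killedHitProb, hz]
  · refine tendsto_nhds_unique (hsucc z) ?_
    simp [killedHitProb, hz, hzK]
  · refine tendsto_nhds_unique (hsucc z) ?_
    simp only [killedHitProb, hz, hzK, if_true, if_false]
    exact tendsto_finsetSum _ fun w _ => (hlim w).const_mul _

/-! ### Harmonic extension equals hitting probability -/

lemma eq_sum_smul_delta {K : Finset V} {f : V → ℝ} (hf : ∀ z ∉ K, f z = 0) :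
    f = (∑ z ∈ K, f z • G.delta z : G.domainSubmodule).1 := by
  ext w
  rw [Submodule.coe_sum, Finset.sum_apply]
  simp only [Submodule.coe_smul, Pi.smul_apply, smul_eq_mul]
  by_cases hw : w ∈ K
  · rw [Finset.sum_eq_single w (fun z _ hz => by rw [G.delta_of_ne hz.symm, mul_zero])
      (fun h => absurd hw h), G.delta_self, mul_one]
  · rw [hf w hw, Finset.sum_eq_zero]
    intro z hz
    rw [G.delta_of_ne (by rintro rfl; exact hw hz), mul_zero]

lemma inner_grad_eq_zero {K : Finset V} {f g : G.domainSubmodule} (hf : ∀ z ∉ K, f.1 z = 0)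
    (hg : ∀ z, f.1 z ≠ 0 → ∑' w, G.cond z w * g.1 w = G.totalCond z * g.1 z) :
    inner ℝ (G.grad f) (G.grad g) = 0 := by
  have h := Subtype.ext (G.eq_sum_smul_delta hf)
  rw [h, map_sum, sum_inner]
  refine Finset.sum_eq_zero fun z _ => ?_
  rw [map_smul, real_inner_smul_left, inner_grad_delta]
  by_cases hz : f.1 z = 0
  · rw [hz, zero_mul]
  · rw [hg z hz, sub_self, mul_zero, mul_zero]

variable {G} in
/-- The harmonic extension of the indicator of `y` is the hitting probability of `y`. -/
lemma ofReal_eq_iSup_hitProb [Nontrivial V] {B : Set V} {y : V} (hy : y ∈ B)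
    {h : G.domainSubmodule} (hB : ∀ b ∈ B, h.1 b = (G.delta y).1 b)
    (hcl : G.grad (h - G.delta y) ∈ G.gradClosure B) (hh : G.grad h ∈ (G.gradClosure B)ᗮ)
    (z : V) : 0 ≤ h.1 z ∧ ENNReal.ofReal (h.1 z) = ⨆ n, G.hitProb B y n z := by
  classical
  obtain ⟨v, hv, hlim⟩ := G.exists_seq_of_mem_gradClosure hcl
  -- Including y ensures that the killed hitting probability is supported in `K n`.
  set K : ℕ → Finset V := fun n => insert y (hv n).1.toFinset with hK
  choose p hp0 hple hpB hpK hpharm using fun n => G.exists_killed_limit B y (K n)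
  have hpsupp : ∀ n, ∀ z ∉ K n, p n z = 0 := fun n z hz => by
    by_cases hzB : z ∈ B
    · rw [hpB n z hzB, Set.indicator_of_notMem]
      rintro rfl
      exact hz (Finset.mem_insert_self _ _)
    · exact hpK n z hzB hz
  have hpdom : ∀ n, p n ∈ G.domain := fun n => by
    rw [G.eq_sum_smul_delta (hpsupp n)]
    exact (∑ z ∈ K n, p n z • G.delta z : G.domainSubmodule).2
  set q : ℕ → G.domainSubmodule := fun n => ⟨p n, hpdom n⟩ with hq
  have hpeq : ∀ n, ∀ z ∉ B, z ∈ K n →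
      ∑' w, G.cond z w * p n w = G.totalCond z * p n z := fun n z hz hzK => by
    rw [tsum_eq_sum (s := K n) fun w hw => by rw [hpsupp n w hw, mul_zero], hpharm n z hz hzK,
      Finset.mul_sum]
    refine Finset.sum_congr rfl fun w _ => ?_
    rw [← mul_assoc, G.totalCond_mul_trans]
  have hle : ∀ n, ‖G.grad (q n) - G.grad h‖ ≤ ‖G.grad (v n) - G.grad (h - G.delta y)‖ := by
    intro n
    -- `φ` compares the killed solution with the approximant δ_y + v_n. It is supported in `K n` off
    -- B, where `q n` is harmonic, so its gradient is orthogonal to those of both `h` and `q n`.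
    set φ : G.domainSubmodule := q n - G.delta y - v n with hφ
    have hφK : ∀ z ∉ K n, φ.1 z = 0 := fun z hz => by
      have h1 : z ≠ y := fun e => hz (e ▸ Finset.mem_insert_self _ _)
      have h2 : (v n).1 z = 0 := by
        by_contra h2
        exact hz (Finset.mem_insert_of_mem ((hv n).1.mem_toFinset.2 h2))
      simp [hφ, hq, hpsupp n z hz, G.delta_of_ne h1, h2]
    have hφB : ∀ b ∈ B, φ.1 b = 0 := fun b hb => by
      simp [hφ, hq, hpB n b hb, (hv n).2 b hb, delta]
    have hφmem : φ ∈ G.finsuppOff B :=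
      ⟨(K n).finite_toSet.subset fun z hz => by_contra fun h' => hz (hφK z h'), hφB⟩
    have h1 : inner ℝ (G.grad φ) (G.grad h) = 0 :=
      (Submodule.mem_orthogonal _ _).1 hh _ (G.grad_mem_gradClosure hφmem)
    have h2 : inner ℝ (G.grad φ) (G.grad (q n)) = 0 :=
      G.inner_grad_eq_zero hφK fun z hz =>
        hpeq n z (fun hzB => hz (hφB z hzB)) (by_contra fun hzK => hz (hφK z hzK))
    have h3 : G.grad (v n) - G.grad (h - G.delta y) =
        (G.grad (q n) - G.grad h) - G.grad φ := by
      simp only [hφ, map_sub]; abel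
    have h4 : ‖G.grad (v n) - G.grad (h - G.delta y)‖ ^ 2 =
        ‖G.grad (q n) - G.grad h‖ ^ 2 + ‖G.grad φ‖ ^ 2 := by
      rw [h3, norm_sub_sq_real, real_inner_comm, inner_sub_right, h1, h2]; ring
    refine le_of_sq_le_sq ?_ (norm_nonneg _)
    rw [h4]
    exact le_add_of_nonneg_right (sq_nonneg _)
  have hgrad : Tendsto (fun n => G.grad (q n)) atTop (𝓝 (G.grad h)) := by
    rw [tendsto_iff_norm_sub_tendsto_zero] at hlim ⊢
    exact squeeze_zero (fun _ => norm_nonneg _) hle hlim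
  have hpt := G.tendsto_apply_of_tendsto_grad hgrad (b := y)
    (tendsto_const_nhds.congr fun n => by simp [hq, hpB n y hy, hB y hy, delta])
  have hnonneg : ∀ z, 0 ≤ h.1 z := fun z => ge_of_tendsto' (hpt z) fun n => hp0 n z
  refine ⟨hnonneg z, le_antisymm ?_ (iSup_le fun n => ?_)⟩
  · exact le_of_tendsto' ((ENNReal.continuous_ofReal.tendsto _).comp (hpt z)) fun n => hple n z
  · have hbase : ∀ z ∈ B, Set.indicator {y} (fun _ => (1 : ℝ≥0∞)) z ≤ ENNReal.ofReal (h.1 z) := by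
      intro z hz
      rw [hB z hz]
      by_cases hzy : z = y <;> simp [hzy, delta]
    induction n generalizing z with
    | zero =>
      by_cases hz : z ∈ B
      · exact hbase z hz
      · have : z ≠ y := fun e => hz (e ▸ hy)
        simp [hitProb, this]
    | succ n ih =>
      rw [hitProb]
      split_ifs with hz
      · exact hbase z hz
      -- Off B the mean of `h` over the next step equals its value, so the bound passes from n to n
      -- + 1.
      · refine (ENNReal.tsum_le_tsum fun w => mul_le_mul_right (ih w) _).trans ?_
        simp_rw [← ENNReal.ofReal_mul (G.trans_nonneg z _)]
        have h1 : (fun w => G.trans z w * h.1 w) =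
            fun w => (G.totalCond z)⁻¹ * (G.cond z w * h.1 w) := by
          ext w; rw [trans]; ring
        rw [← ENNReal.ofReal_tsum_of_nonneg
          (fun w => mul_nonneg (G.trans_nonneg z w) (hnonneg w))
          (h1 ▸ (G.summable_cond_mul h z).mul_left _), h1, tsum_mul_left,
          G.tsum_cond_mul_eq hh hz, inv_mul_cancel_left₀ (G.totalCond_pos z).ne']

end ElectricalNetwork

/-! ### The chain and its first return to B -/

lemma ENNReal.tsum_iSup_of_monotone {ι : Type*} {f : ι → ℕ → ℝ≥0∞} (hf : ∀ i, Monotone (f i)) :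
    ∑' i, ⨆ n, f i n = ⨆ n, ∑' i, f i n := by
  refine le_antisymm ?_ (iSup_le fun n => ENNReal.tsum_le_tsum fun i => le_iSup (f i) n)
  rw [ENNReal.tsum_eq_iSup_sum]
  refine iSup_le fun s => ?_
  rw [ENNReal.finsetSum_iSup_of_monotone hf]
  exact iSup_mono fun n => ENNReal.sum_le_tsum s

lemma returnTime_eq_coe_iff {V Ω : Type*} (Y : ℕ → Ω → V) (B : Set V) (ω : Ω) (n : ℕ) :
    returnTime Y B ω = n ↔ 0 < n ∧ Y n ω ∈ B ∧ ∀ j, 0 < j → j < n → Y j ω ∉ B := by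
  rw [returnTime]
  constructor
  · intro h
    have hne : Nonempty {n : ℕ // 0 < n ∧ Y n ω ∈ B} := by
      by_contra hemp
      rw [not_nonempty_iff] at hemp
      simp at h
    obtain ⟨m, hm⟩ := ciInf_mem fun n : {n : ℕ // 0 < n ∧ Y n ω ∈ B} => (n.1 : ℕ∞)
    have hmn : m.1 = n := by
      exact Nat.cast_injective (R := ℕ∞) (hm.trans h)
    refine ⟨hmn ▸ m.2.1, hmn ▸ m.2.2, fun j hj hjn hjB => ?_⟩
    have h1 : (n : ℕ∞) ≤ j := h ▸ iInf_le
      (fun n : {n : ℕ // 0 < n ∧ Y n ω ∈ B} => (n.1 : ℕ∞)) ⟨j, hj, hjB⟩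
    exact absurd (by exact_mod_cast h1) hjn.not_ge
  · rintro ⟨h0, hB, hlt⟩
    refine le_antisymm (iInf_le_of_le ⟨n, h0, hB⟩ le_rfl) (le_iInf fun m => ?_)
    have h1 : n ≤ m.1 := by
      by_contra h1
      exact hlt m.1 m.2.1 (not_le.1 h1) m.2.2
    exact_mod_cast h1

namespace ElectricalNetwork

variable {V : Type*} {G : ElectricalNetwork V} {Ω : Type*} [MeasurableSpace Ω] {P : Measure Ω}
  {Y : ℕ → Ω → V} {x : V}

lemma IsChainFrom.measurable_mem (hY : G.IsChainFrom P Y x) (k : ℕ) (S : Set V) :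
    Measurable fun ω => Y k ω ∈ S :=
  measurableSet_setOfPred.1 (hY.measurable k trivial)

lemma IsChainFrom.measurable_forall_eq (hY : G.IsChainFrom P Y x) (m : ℕ) (p : ℕ → V) :
    Measurable fun ω => ∀ k ≤ m, Y k ω = p k :=
  Measurable.forall fun k => Measurable.forall fun _ => hY.measurable_mem k {p k}

lemma IsChainFrom.measurable_hit (hY : G.IsChainFrom P Y x) (B : Set V) (y : V) (m n : ℕ) :
    Measurable fun ω => ∃ k ≤ n, Y (m + k) ω = y ∧ ∀ j < k, Y (m + j) ω ∉ B :=
  Measurable.exists fun k => (measurable_const (a := k ≤ n)).and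
    ((hY.measurable_mem (m + k) {y}).and (Measurable.forall fun j => Measurable.forall fun _ =>
      (hY.measurable_mem (m + j) B).not))

lemma IsChainFrom.measure_step (hY : G.IsChainFrom P Y x) (n : ℕ) (p : ℕ → V) :
    P {ω | ∀ k ≤ n + 1, Y k ω = p k} =
      P {ω | ∀ k ≤ n, Y k ω = p k} * ENNReal.ofReal (G.trans (p n) (p (n + 1))) := by
  have := hY.isProbabilityMeasure
  rw [← ofReal_measureReal, hY.step, ENNReal.ofReal_mul measureReal_nonneg, ofReal_measureReal]

lemma forall_le_succ_update_iff (f p : ℕ → V) (m : ℕ) (w : V) :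
    (∀ k ≤ m + 1, f k = Function.update p (m + 1) w k) ↔
      (∀ k ≤ m, f k = p k) ∧ f (m + 1) = w := by
  constructor
  · intro h
    refine ⟨fun k hk => ?_, by simpa using h (m + 1) le_rfl⟩
    have := h k (by omega)
    rwa [Function.update_of_ne (by omega)] at this
  · rintro ⟨h, hw⟩ k hk
    rcases Nat.lt_or_ge m k with hmk | hmk
    · obtain rfl : k = m + 1 := by omega
      simpa using hw
    · rw [Function.update_of_ne (by omega)]
      exact h k hmk

/-- Decomposition over the next vertex of the path. -/
lemma IsChainFrom.measure_eq_tsum [Countable V] (hY : G.IsChainFrom P Y x) (m : ℕ) (p : ℕ → V)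
    {E : Ω → Prop} (hE : Measurable E) :
    P {ω | (∀ k ≤ m, Y k ω = p k) ∧ E ω} =
      ∑' w, P {ω | (∀ k ≤ m + 1, Y k ω = Function.update p (m + 1) w k) ∧ E ω} := by
  rw [← measure_iUnion]
  · congr 1
    ext ω
    simp only [forall_le_succ_update_iff, Set.mem_ofPred_eq, Set.mem_iUnion]
    exact ⟨fun h => ⟨_, ⟨h.1, rfl⟩, h.2⟩, fun ⟨_, h, hE⟩ => ⟨h.1, hE⟩⟩
  · intro w w' hww'
    refine Set.disjoint_left.2 fun ω h h' => hww' ?_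
    simp only [forall_le_succ_update_iff, Set.mem_ofPred_eq] at h h'
    exact h.1.2.symm.trans h'.1.2
  · exact fun w => measurableSet_setOfPred.2 ((hY.measurable_forall_eq _ _).and hE)

/-- The Markov property for the first visit to `B`. -/
lemma IsChainFrom.measure_hit [Countable V] (hY : G.IsChainFrom P Y x) {B : Set V} {y : V}
    (hy : y ∈ B) (n m : ℕ) (p : ℕ → V) :
    P {ω | (∀ k ≤ m, Y k ω = p k) ∧
        ∃ k ≤ n, Y (m + k) ω = y ∧ ∀ j < k, Y (m + j) ω ∉ B} =
      P {ω | ∀ k ≤ m, Y k ω = p k} * G.hitProb B y n (p m) := by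
  -- With no steps left, or already in B at time m, the only possible first visit is at time m.
  have hfirst : ∀ (n m : ℕ) (p : ℕ → V), (n = 0 ∨ p m ∈ B) →
      P {ω | (∀ k ≤ m, Y k ω = p k) ∧
        ∃ k ≤ n, Y (m + k) ω = y ∧ ∀ j < k, Y (m + j) ω ∉ B} =
      P {ω | ∀ k ≤ m, Y k ω = p k} * Set.indicator {y} (fun _ => 1) (p m) := by
    intro n m p hn
    have hset : {ω | (∀ k ≤ m, Y k ω = p k) ∧
        ∃ k ≤ n, Y (m + k) ω = y ∧ ∀ j < k, Y (m + j) ω ∉ B} =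
        {ω | (∀ k ≤ m, Y k ω = p k) ∧ p m = y} := by
      ext ω
      refine and_congr_right fun h => ?_
      rw [← h m le_rfl] at hn ⊢
      constructor
      · rintro ⟨k, hk, hky, hkB⟩
        rcases Nat.eq_zero_or_pos k with rfl | hpos
        · exact hky
        · rcases hn with rfl | hn
          · omega
          · exact absurd hn (hkB 0 hpos)
      · exact fun h => ⟨0, Nat.zero_le _, h, by simp⟩
    rw [hset]
    by_cases h : p m = y <;> simp [h]
  induction n generalizing m p with
  | zero => exact hfirst 0 m p (Or.inl rfl)
  | succ n ih =>
    by_cases hB : p m ∈ B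
    · rw [hfirst (n + 1) m p (Or.inr hB), hitProb, if_pos hB]
    · rw [hitProb, if_neg hB, hY.measure_eq_tsum m p (hY.measurable_hit B y m (n + 1)),
        ← ENNReal.tsum_mul_left]
      refine tsum_congr fun w => ?_
      have h1 := ih (m + 1) (Function.update p (m + 1) w)
      rw [hY.measure_step, Function.update_self, Function.update_of_ne (by omega)] at h1
      rw [← mul_assoc]
      convert h1 using 2
      · ext ω
        refine and_congr_right fun h => ?_
        have hm : Y m ω ∉ B := by
          rw [h m (by omega), Function.update_of_ne (by omega)]; exact hB
        constructor
        · rintro ⟨k, hk, hky, hkB⟩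
          cases k with
          | zero => exact absurd (hky ▸ hy) hm
          | succ k =>
            refine ⟨k, by omega, by rwa [Nat.add_right_comm], fun j hj => ?_⟩
            rw [Nat.add_right_comm]
            exact hkB (j + 1) (by omega)
        · rintro ⟨k, hk, hky, hkB⟩
          refine ⟨k + 1, by omega, by rwa [Nat.add_right_comm] at hky, fun j hj => ?_⟩
          cases j with
          | zero => exact hm
          | succ j =>
            have := hkB j (by omega)
            rwa [Nat.add_right_comm] at this
      · congr 2
        ext ω
        refine forall₂_congr fun k hk => ?_
        rw [Function.update_of_ne (by omega)]

/-- The law of the vertex at which the chain returns to `B`. -/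
lemma IsChainFrom.measure_return [Countable V] (hY : G.IsChainFrom P Y x) {B : Set V} {y : V}
    (hy : y ∈ B) :
    P {ω | ∃ n : ℕ, returnTime Y B ω = n ∧ Y n ω = y} =
      ∑' w, ENNReal.ofReal (G.trans x w) * ⨆ n, G.hitProb B y n w := by
  have := hY.isProbabilityMeasure
  -- A return at a positive time is a first visit counted from time 1, so k is the return time minus
  -- one.
  set R : ℕ → Set Ω := fun n => {ω | ∃ k ≤ n, Y (1 + k) ω = y ∧ ∀ j < k, Y (1 + j) ω ∉ B} with hR
  have hset : {ω | ∃ n : ℕ, returnTime Y B ω = n ∧ Y n ω = y} = ⋃ n, R n := by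
    ext ω
    simp only [hR, Set.mem_ofPred_eq, Set.mem_iUnion, returnTime_eq_coe_iff]
    constructor
    · rintro ⟨n, ⟨h0, -, hlt⟩, hny⟩
      obtain ⟨k, rfl⟩ := Nat.exists_eq_add_of_le h0
      exact ⟨k, k, le_rfl, hny, fun j hj => hlt _ (by omega) (by omega)⟩
    · rintro ⟨n, k, -, hky, hkB⟩
      refine ⟨1 + k, ⟨by omega, hky ▸ hy, fun j hj hjk => ?_⟩, hky⟩
      obtain ⟨i, rfl⟩ := Nat.exists_eq_add_of_le (show 1 ≤ j from hj)
      exact hkB i (by omega)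
  have hmono : Monotone R := fun a b hab ω ⟨k, hk, h⟩ => ⟨k, hk.trans hab, h⟩
  have hstart : P {ω | ∀ k ≤ 0, Y k ω = x} = 1 := by
    rw [← mem_ae_iff_prob_eq_one (measurableSet_setOfPred.2
      (hY.measurable_forall_eq 0 fun _ => x))]
    filter_upwards [hY.start] with ω h k hk
    obtain rfl : k = 0 := by omega
    exact h
  have hRn : ∀ n, P (R n) = ∑' w, ENNReal.ofReal (G.trans x w) * G.hitProb B y n w := by
    intro n
    have h1 : P (R n) = P {ω | (∀ k ≤ 0, Y k ω = x) ∧ ω ∈ R n} := by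
      refine measure_congr ?_
      filter_upwards [hY.start] with ω h
      refine propext ⟨fun hω => ⟨fun k hk => ?_, hω⟩, fun hω => hω.2⟩
      obtain rfl : k = 0 := by omega
      exact h
    rw [h1]
    refine (hY.measure_eq_tsum 0 (fun _ => x) (hY.measurable_hit B y 1 n)).trans ?_
    refine tsum_congr fun w => ?_
    refine (hY.measure_hit hy n 1 (Function.update (fun _ => x) (0 + 1) w)).trans ?_
    have h2 := hY.measure_step 0 (Function.update (fun _ => x) (0 + 1) w)
    rw [zero_add] at h2 ⊢
    rw [h2, Function.update_self, Function.update_of_ne (by omega)]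
    have h3 : {ω | ∀ k ≤ 0, Y k ω = Function.update (fun _ => x) 1 w k} =
        {ω | ∀ k ≤ 0, Y k ω = x} := by
      ext ω
      refine forall₂_congr fun k hk => ?_
      rw [Function.update_of_ne (by omega)]
    rw [h3, hstart, one_mul]
  rw [hset, hmono.measure_iUnion]
  simp_rw [hRn, ENNReal.mul_iSup]
  refine (ENNReal.tsum_iSup_of_monotone fun w => ?_).symm
  exact fun a b hab => mul_le_mul_right (G.monotone_hitProb hy w hab) _

end ElectricalNetwork

/-! ### Comparison of trace conductance and return law -/

theorem theorem4 {V : Type*} [Countable V] (G : ElectricalNetwork V) (hG : G.IsRecurrent)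
    (B : Set V) (x y : B) (hxy : x ≠ y)
    {Ω : Type*} [MeasurableSpace Ω] (P : Measure Ω) (Y : ℕ → Ω → V)
    (hY : G.IsChainFrom P Y x) :
    G.traceCond B x y =
      G.totalCond x * P.real {ω | ∃ n : ℕ, returnTime Y B ω = n ∧ Y n ω = y} := by
  have hxy' : (x : V) ≠ y := fun h => hxy (Subtype.ext h)
  -- With two vertices, connectedness makes all total conductances positive, so division by c(x) is
  -- harmless.
  have : Nontrivial V := ⟨⟨x, y, hxy'⟩⟩
  have hB : B.Nonempty := ⟨x, x.2⟩
  have hdelta : ∀ z b : B, (G.delta z).1 b = Set.indicator {z} (fun _ => (1 : ℝ)) b := by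
    intro z b
    by_cases hbz : b = z
    · simp [ElectricalNetwork.delta, hbz]
    · simp [ElectricalNetwork.delta, hbz, Subtype.coe_inj]
  obtain ⟨f, hf1, hfB, hfcl, hfo⟩ := G.exists_harmonic hB (G.delta x) (G.support_delta_finite x)
  obtain ⟨h, hh1, hhB, hhcl, hho⟩ := G.exists_harmonic hB (G.delta y) (G.support_delta_finite y)
  have hfext := G.harmonicExt_eq hB hf1 hfo fun b => (hfB b b.2).trans (hdelta x b)
  have hhext := G.harmonicExt_eq hB hh1 hho fun b => (hhB b b.2).trans (hdelta y b)
  have hhx : h.1 x = 0 := by rw [hhB x x.2, G.delta_of_ne hxy']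
  -- Orthogonality of `h` to M lets 1_x replace its harmonic extension, reducing the trace energy to
  -- a Laplacian at x.
  have hinner : inner ℝ (G.grad f) (G.grad h) = inner ℝ (G.grad (G.delta x)) (G.grad h) := by
    rw [← sub_eq_zero, ← inner_sub_left, ← map_sub]
    exact (Submodule.mem_orthogonal _ _).1 hho _ hfcl
  rw [G.inner_grad, G.inner_grad_delta, hhx] at hinner
  have hhit := ElectricalNetwork.ofReal_eq_iSup_hitProb y.2 hhB hhcl hho
  have hsum : (fun w => G.trans x w * h.1 w) =
      fun w => (G.totalCond x)⁻¹ * (G.cond x w * h.1 w) := by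
    ext w; rw [ElectricalNetwork.trans]; ring
  have hnonneg : ∀ w, 0 ≤ G.trans x w * h.1 w := fun w =>
    mul_nonneg (G.trans_nonneg x w) (hhit w).1
  have hP : P.real {ω | ∃ n : ℕ, returnTime Y B ω = n ∧ Y n ω = y} =
      (G.totalCond x)⁻¹ * ∑' w, G.cond x w * h.1 w := by
    rw [measureReal_def, hY.measure_return y.2]
    simp_rw [← fun w => (hhit w).2, ← ENNReal.ofReal_mul (G.trans_nonneg x _)]
    rw [← ENNReal.ofReal_tsum_of_nonneg hnonneg
      (hsum ▸ (G.summable_cond_mul h x).mul_left _), ENNReal.toReal_ofReal (tsum_nonneg hnonneg),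
      hsum, tsum_mul_left]
  rw [hP, mul_inv_cancel_left₀ (G.totalCond_pos x).ne', ElectricalNetwork.traceCond, if_neg hxy,
    ElectricalNetwork.traceEnergy, hfext, hhext]
  linarith
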